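/- Let $p$ parties hold particles with Hilbert spaces $\mathbb{C}^{d_1},\dots,\mathbb{C}^{d_p}$. For $\mathbf{x}=(x_1,\dots,x_p)$ with $x_k\ge 0$ and $\sum_k x_k\le 1$ put $x_0=1-\sum_k x_k$. A state has parameter vector $\mathbf{x}$ if, for some orthonormal pairs $\{|\alpha_k\rangle,|\beta_k\rangle\}$ in the local Hilbert spaces, it equals $$\sqrt{x_0}\,|\alpha_1\cdots\alpha_p\rangle+\sum_{k=1}^p\sqrt{x_k}\,|\alpha_1\cdots\alpha_{k-1}\beta_k\alpha_{k+1}\cdots\alpha_p\rangle .$$ An LOCC protocol is a finite sequence of measurements, each carried out by one party, $|\psi\rangle\mapsto M_\lambda|\psi\rangle$ with finitely many outcomes $\lambda$ and $\sum_\lambda M_\lambda^\dagger M_\lambda=1$ on that party's space, where party and measurement may depend on all previous outcomes. Let $\Psi$ be a state with parameter vector $\mathbf{x}$, and let $\mathbf{y}$ be the parameter vector of a truly multipartite state (at least three parties are entangled with each other). The success probability $P$ of a protocol started in $\Psi$ is the total probability of the outcome sequences whose final state has parameter vector $\mathbf{y}$. Put $$\mathcal{P}_{\mathrm{bnd}}(\mathbf{x}\to\mathbf{y})=\min\Big(\frac{x_1}{y_1},\dots,\frac{x_p}{y_p},1\Big),$$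 where terms with $y_k=0$ are omitted (counted as $+\infty$). Then: 1. Every LOCC protocol satisfies $P\le \mathcal{P}_{\mathrm{bnd}}(\mathbf{x}\to\mathbf{y})$. 2. If $x_0=y_0=0$, the bound is attained by a sequential two-outcome protocol: the parties $k$ with $x_k>\mathcal{P}_{\mathrm{bnd}}(\mathbf{x}\to\mathbf{y})\,y_k$ act one after the other, in any prescribed order, each by one two-outcome measurement; after a failure outcome the protocol stops, and after a success outcome the next party acts. 3. If $\mathbf{x}=t\mathbf{y}$ with $0<t<1$ (so that $x_0\neq 0$ automatically), then $\mathcal{P}_{\mathrm{bnd}}(\mathbf{x}\to\mathbf{y})=t$, and the supremum of $P$ over all LOCC protocols is strictly smaller than $t$; in particular no protocol attains the bound. -/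

import Mathlib

noncomputable section

namespace WType

open scoped Matrix

/-- Vectors of `⨂ₖ ℂ^(d k)`, given by their amplitudes in the product basis.  There are `p`
parties, and party `k` holds a particle with Hilbert space `ℂ^(d k)` (qubits: `d k = 2`). -/
abbrev State {p : ℕ} (d : Fin p → ℕ) : Type :=
  EuclideanSpace ℂ (∀ k, Fin (d k))

/-- The product vector `u₁ ⊗ ⋯ ⊗ u_p`. -/
def productVec {p : ℕ} {d : Fin p → ℕ} (u : ∀ k, EuclideanSpace ℂ (Fin (d k))) : State d :=
  WithLp.toLp 2 (fun i => ∏ k, u k (i k))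

/-- The simplex of parameter vectors: `x k ≥ 0` and `x₁ + ⋯ + x_p ≤ 1`. -/
def simplex (p : ℕ) : Set (Fin p → ℝ) :=
  {x | (∀ k, 0 ≤ x k) ∧ ∑ k, x k ≤ 1}

/-- The zeroth component `x₀ = 1 - (x₁ + ⋯ + x_p)` of a parameter vector. -/
def zeroth {p : ℕ} (x : Fin p → ℝ) : ℝ :=
  1 - ∑ k, x k

/-- `Ψ` is a (normalized) `W`-type state with parameter vector `x`: for suitable orthonormal
pairs `α k, β k` in the local Hilbert spaces,
`Ψ = √x₀ |α₁ ⋯ α_p⟩ + ∑ₖ √xₖ |α₁ ⋯ αₖ₋₁ βₖ αₖ₊₁ ⋯ α_p⟩`. -/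
def HasParam {p : ℕ} {d : Fin p → ℕ} (Ψ : State d) (x : Fin p → ℝ) : Prop :=
  x ∈ simplex p ∧
    ∃ α β : ∀ k, EuclideanSpace ℂ (Fin (d k)),
      (∀ k, Orthonormal ℂ ![α k, β k]) ∧
      Ψ = ((Real.sqrt (zeroth x) : ℝ) : ℂ) • productVec α +
        ∑ k, ((Real.sqrt (x k) : ℝ) : ℂ) • productVec (Function.update α k (β k))

/-- `Ψ` is a product of a vector of the parties in `A` and a vector of the other parties,
that is, `A` is not entangled with the rest. -/
def IsProductAcross {p : ℕ} {d : Fin p → ℕ} (Ψ : State d) (A : Finset (Fin p)) : Prop :=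
  ∃ (f : (∀ k : {k // k ∈ A}, Fin (d k)) → ℂ) (g : (∀ k : {k // k ∉ A}, Fin (d k)) → ℂ),
    ∀ i : ∀ k, Fin (d k), Ψ i = f (fun k => i k) * g (fun k => i k)

/-- At least three parties are entangled with each other: there is a set `R` of at least three
parties such that `Ψ` does not factorize across any cut that separates members of `R`. -/
def TrulyMultipartite {p : ℕ} {d : Fin p → ℕ} (Ψ : State d) : Prop :=
  ∃ R : Finset (Fin p), 3 ≤ R.card ∧
    ∀ A : Finset (Fin p), (∃ k ∈ R, k ∈ A) → (∃ k ∈ R, k ∉ A) → ¬ IsProductAcross Ψ A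

/-- The operator `M` of party `k`, tensored with the identity of the other parties. -/
def applyLocal {p : ℕ} {d : Fin p → ℕ} (k : Fin p) (M : Matrix (Fin (d k)) (Fin (d k)) ℂ)
    (ψ : State d) : State d :=
  WithLp.toLp 2 (fun i => ∑ a, M (i k) a * ψ (Function.update i k a))

/-- LOCC protocols.  A protocol either stops, or some party `k` carries out a general measurement
with measurement operators `M₀, …, Mₙ₋₁`, `∑ⱼ Mⱼ† Mⱼ = 1`, announces the outcome `j`, and all
parties go on with the protocol `next j`. -/
inductive Protocol {p : ℕ} (d : Fin p → ℕ) : Type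
  | halt : Protocol d
  | measure (k : Fin p) (n : ℕ) (M : Fin n → Matrix (Fin (d k)) (Fin (d k)) ℂ)
      (hM : ∑ j, (M j)ᴴ * M j = 1) (next : Fin n → Protocol d) : Protocol d

open Classical in
/-- The total probability of those outcome sequences of a protocol whose final state has the
parameter vector `y`.  The state `ψ` is propagated without normalization, so that on a branch
its squared norm is the probability of that branch. -/
def successProb {p : ℕ} {d : Fin p → ℕ} (y : Fin p → ℝ) : Protocol d → State d → ℝ
  | .halt, ψ => if HasParam (((‖ψ‖⁻¹ : ℝ) : ℂ) • ψ) y then ‖ψ‖ ^ 2 else 0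
  | .measure k _ M _ next, ψ => ∑ j, successProb y (next j) (applyLocal k (M j) ψ)

/-- Sequential two-outcome protocols: the parties in the list act one after the other, each by one
two-outcome measurement; after outcome `0` (failure) the protocol stops, and after outcome `1`
(success) the next party in the list acts. -/
inductive IsSequentialTwoOutcome {p : ℕ} {d : Fin p → ℕ} : List (Fin p) → Protocol d → Prop
  | nil : IsSequentialTwoOutcome [] Protocol.halt
  | cons (k : Fin p) (l : List (Fin p)) (M : Fin 2 → Matrix (Fin (d k)) (Fin (d k)) ℂ)
      (hM : ∑ j, (M j)ᴴ * M j = 1) (next : Fin 2 → Protocol d)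
      (failure : next 0 = Protocol.halt) (success : IsSequentialTwoOutcome l (next 1)) :
      IsSequentialTwoOutcome (k :: l) (Protocol.measure k 2 M hM next)

/-- `min (x₁ / y₁, …, x_p / y_p, 1)`, where the terms with `y k = 0` are left out
(they count as `+∞`). -/
def pBnd {p : ℕ} (x y : Fin p → ℝ) : ℝ :=
  (Finset.univ.filter fun k => y k ≠ 0).fold min 1 fun k => x k / y k

end WType

end

noncomputable section

namespace WType

open scoped Matrix
open Finset Function

variable {p : ℕ} {d : Fin p → ℕ}

/-! Unnormalized vectors are tracked through complex amplitudes `(z0, z)` relative to a frame. In a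
suitable new frame a local operator of party `k` is upper triangular, so the W-type form survives
and the amplitudes become `a z0 + b z k`, `a z l` for `l ≠ k`, and `c z k`
(`IsFrame.exists_applyLocal_eq`). Completeness of the measurement leaves three scalar identities for
`a, b, c`. The normal form is rigid when three amplitudes are nonzero (`norm_le_norm_of_wVec_eq`): a
final vector of weight `w` counted as a success satisfies `w * y k ≤ ‖z k‖ ^ 2` for all `k`. Hence
any function of the amplitudes that does not increase on average bounds the success probability
(`successProb_wVec_le`). The weight gives the bound `1`, and `‖z k‖ ^ 2` gives `x k / y k`. For `x =
t • y` the function is `e₂(‖z‖ ^ 2) / weight`, with `e₂` the second elementary symmetric polynomial.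
It is quadratic over linear, hence contributes `t ^ 2` at the start and at least `w` on a success of
weight `w`, in units of `e₂(y)`. So `P ≤ t ^ 2 < t`. Attainment when `x₀ = y₀ = 0`: each party with
surplus damps `β k` until all squared amplitudes equal `pBnd x y * y k`; a failure leaves a product
vector. -/

/-- The vector with amplitude `z0` on `α₁ ⊗ ⋯ ⊗ α_p` and amplitude `z k` on the product in which
`β k` replaces `α k`. -/
def wVec (α β : ∀ k, EuclideanSpace ℂ (Fin (d k))) (z0 : ℂ) (z : Fin p → ℂ) : State d :=
  z0 • productVec α + ∑ k, z k • productVec (update α k (β k))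

/-- The family `(α k, β k)` consists of orthonormal pairs. -/
def IsFrame (α β : ∀ k, EuclideanSpace ℂ (Fin (d k))) : Prop :=
  ∀ k, Orthonormal ℂ ![α k, β k]

/-- The squared norm of `wVec` in terms of the amplitudes. -/
def weight (z0 : ℂ) (z : Fin p → ℂ) : ℝ :=
  ‖z0‖ ^ 2 + ∑ k, ‖z k‖ ^ 2

/-! ### Product vectors, local operators and amplitudes in a frame. -/

theorem orthonormal_pair_iff {E : Type*} [NormedAddCommGroup E] [InnerProductSpace ℂ E]
    {e f : E} : Orthonormal ℂ ![e, f] ↔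
      inner ℂ e e = 1 ∧ inner ℂ f f = 1 ∧ inner ℂ e f = 0 ∧ inner ℂ f e = 0 := by
  rw [orthonormal_iff_ite]
  constructor
  · intro h
    exact ⟨by simpa using h 0 0, by simpa using h 1 1, by simpa using h 0 1,
      by simpa using h 1 0⟩
  · rintro ⟨h1, h2, h3, h4⟩ i j
    fin_cases i <;> fin_cases j <;> simp_all [inner_self_eq_norm_sq_to_K]

theorem inner_productVec (u v : ∀ k, EuclideanSpace ℂ (Fin (d k))) :
    inner ℂ (productVec u) (productVec v) = ∏ k, inner ℂ (u k) (v k) := by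
  simp only [PiLp.inner_apply, productVec]
  rw [Finset.prod_univ_sum, Fintype.piFinset_univ]
  refine Finset.sum_congr rfl fun i _ => ?_
  simp [Finset.prod_mul_distrib, mul_comm]

theorem productVec_update_apply (u : ∀ k, EuclideanSpace ℂ (Fin (d k))) (k : Fin p)
    (v : EuclideanSpace ℂ (Fin (d k))) (i : ∀ k, Fin (d k)) :
    productVec (update u k v) i = v (i k) * ∏ l ∈ univ.erase k, u l (i l) := by
  simp only [productVec]
  rw [← Finset.mul_prod_erase _ _ (mem_univ k)]
  congr 1
  · simp
  · refine Finset.prod_congr rfl fun l hl => ?_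
    rw [update_of_ne (ne_of_mem_erase hl)]

theorem productVec_update_add (u : ∀ k, EuclideanSpace ℂ (Fin (d k))) (k : Fin p)
    (v w : EuclideanSpace ℂ (Fin (d k))) :
    productVec (update u k (v + w)) = productVec (update u k v) + productVec (update u k w) := by
  ext i
  simp [productVec_update_apply, add_mul]

theorem productVec_update_smul (u : ∀ k, EuclideanSpace ℂ (Fin (d k))) (k : Fin p) (c : ℂ)
    (v : EuclideanSpace ℂ (Fin (d k))) :
    productVec (update u k (c • v)) = c • productVec (update u k v) := by
  ext i
  simp [productVec_update_apply, mul_assoc]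

theorem applyLocal_add (k : Fin p) (M : Matrix (Fin (d k)) (Fin (d k)) ℂ) (φ ψ : State d) :
    applyLocal k M (φ + ψ) = applyLocal k M φ + applyLocal k M ψ := by
  ext i
  simp [applyLocal, mul_add, Finset.sum_add_distrib]

theorem applyLocal_smul (k : Fin p) (M : Matrix (Fin (d k)) (Fin (d k)) ℂ) (c : ℂ)
    (ψ : State d) : applyLocal k M (c • ψ) = c • applyLocal k M ψ := by
  ext i
  simp [applyLocal, Finset.mul_sum, mul_left_comm]

theorem applyLocal_sum {ι : Type*} (s : Finset ι) (k : Fin p)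
    (M : Matrix (Fin (d k)) (Fin (d k)) ℂ) (ψ : ι → State d) :
    applyLocal k M (∑ j ∈ s, ψ j) = ∑ j ∈ s, applyLocal k M (ψ j) := by
  ext i
  simp only [applyLocal, WithLp.ofLp_sum, Finset.sum_apply, Finset.mul_sum]
  exact Finset.sum_comm

theorem applyLocal_productVec (k : Fin p) (M : Matrix (Fin (d k)) (Fin (d k)) ℂ)
    (u : ∀ k, EuclideanSpace ℂ (Fin (d k))) :
    applyLocal k M (productVec u) = productVec (update u k (Matrix.toEuclideanLin M (u k))) := by
  ext i
  have h : ∀ a, productVec u (update i k a) = u k a * ∏ l ∈ univ.erase k, u l (i l) := by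
    intro a
    simp only [productVec]
    rw [← Finset.mul_prod_erase _ _ (mem_univ k)]
    congr 1
    · simp
    · refine Finset.prod_congr rfl fun l hl => ?_
      rw [update_of_ne (ne_of_mem_erase hl)]
  rw [productVec_update_apply]
  simp only [applyLocal, h, ← mul_assoc, ← Finset.sum_mul]
  rfl

theorem applyLocal_wVec {α β : ∀ k, EuclideanSpace ℂ (Fin (d k))} (k : Fin p)
    {M : Matrix (Fin (d k)) (Fin (d k)) ℂ} {α' β' : EuclideanSpace ℂ (Fin (d k))} {a b c : ℂ}
    (hα : Matrix.toEuclideanLin M (α k) = a • α')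
    (hβ : Matrix.toEuclideanLin M (β k) = b • α' + c • β') (z0 : ℂ) (z : Fin p → ℂ) :
    applyLocal k M (wVec α β z0 z) =
      wVec (update α k α') (update β k β') (a * z0 + b * z k) (update (a • z) k (c * z k)) := by
  have hj : ∀ j ∈ univ.erase k, applyLocal k M (z j • productVec (update α j (β j))) =
      update (a • z) k (c * z k) j •
        productVec (update (update α k α') j (update β k β' j)) := by
    intro j hj
    have hjk := ne_of_mem_erase hj
    rw [applyLocal_smul, applyLocal_productVec, update_of_ne hjk.symm, hα,
      productVec_update_smul, update_of_ne hjk, update_of_ne hjk, update_comm hjk]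
    simp [smul_smul, mul_comm]
  simp only [wVec]
  rw [applyLocal_add, applyLocal_sum, ← Finset.add_sum_erase _ _ (mem_univ k),
    ← Finset.add_sum_erase univ (fun j => update (a • z) k (c * z k) j • _) (mem_univ k),
    Finset.sum_congr rfl hj, applyLocal_smul, applyLocal_smul, applyLocal_productVec,
    applyLocal_productVec, hα]
  simp only [update_self, update_idem, hβ, productVec_update_add, productVec_update_smul]
  module

theorem IsFrame.update {α β : ∀ k, EuclideanSpace ℂ (Fin (d k))} (h : IsFrame α β) (k : Fin p)
    {α' β' : EuclideanSpace ℂ (Fin (d k))} (h' : Orthonormal ℂ ![α', β']) :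
    IsFrame (update α k α') (update β k β') := by
  intro j
  by_cases hj : j = k
  · subst hj
    simpa using h'
  · simpa [hj] using h j

theorem inner_productVec_wVec (u α β : ∀ k, EuclideanSpace ℂ (Fin (d k))) (z0 : ℂ)
    (z : Fin p → ℂ) :
    inner ℂ (productVec u) (wVec α β z0 z) = z0 * ∏ l, inner ℂ (u l) (α l) +
      ∑ k, z k * (inner ℂ (u k) (β k) * ∏ l ∈ univ.erase k, inner ℂ (u l) (α l)) := by
  simp only [wVec, inner_add_right, inner_sum, inner_smul_right, inner_productVec]
  congr 1
  refine Finset.sum_congr rfl fun k _ => ?_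
  rw [← Finset.mul_prod_erase _ _ (mem_univ k), update_self]
  congr 2
  refine Finset.prod_congr rfl fun l hl => ?_
  rw [update_of_ne (ne_of_mem_erase hl)]

theorem inner_productVec_wVec_of_inner_eq_zero {u α β : ∀ k, EuclideanSpace ℂ (Fin (d k))}
    {k : Fin p} (h : inner ℂ (u k) (α k) = 0) (z0 : ℂ) (z : Fin p → ℂ) :
    inner ℂ (productVec u) (wVec α β z0 z) =
      z k * (inner ℂ (u k) (β k) * ∏ l ∈ univ.erase k, inner ℂ (u l) (α l)) := by
  rw [inner_productVec_wVec, Finset.prod_eq_zero (mem_univ k) h, mul_zero, zero_add,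
    Finset.sum_eq_single k _ (by simp)]
  intro j _ hj
  rw [Finset.prod_eq_zero (mem_erase.2 ⟨hj.symm, mem_univ k⟩) h]
  simp

theorem IsFrame.inner_self_left {α β : ∀ k, EuclideanSpace ℂ (Fin (d k))} (h : IsFrame α β)
    (k : Fin p) : inner ℂ (α k) (α k) = 1 :=
  (orthonormal_pair_iff.1 (h k)).1

theorem IsFrame.inner_self_right {α β : ∀ k, EuclideanSpace ℂ (Fin (d k))} (h : IsFrame α β)
    (k : Fin p) : inner ℂ (β k) (β k) = 1 :=
  (orthonormal_pair_iff.1 (h k)).2.1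

theorem IsFrame.inner_left_right {α β : ∀ k, EuclideanSpace ℂ (Fin (d k))} (h : IsFrame α β)
    (k : Fin p) : inner ℂ (α k) (β k) = 0 :=
  (orthonormal_pair_iff.1 (h k)).2.2.1

theorem IsFrame.inner_right_left {α β : ∀ k, EuclideanSpace ℂ (Fin (d k))} (h : IsFrame α β)
    (k : Fin p) : inner ℂ (β k) (α k) = 0 :=
  (orthonormal_pair_iff.1 (h k)).2.2.2

theorem IsFrame.norm_left {α β : ∀ k, EuclideanSpace ℂ (Fin (d k))} (h : IsFrame α β)
    (k : Fin p) : ‖α k‖ = 1 := (h k).1 0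

theorem IsFrame.norm_right {α β : ∀ k, EuclideanSpace ℂ (Fin (d k))} (h : IsFrame α β)
    (k : Fin p) : ‖β k‖ = 1 := (h k).1 1

theorem IsFrame.inner_update_wVec {α β : ∀ k, EuclideanSpace ℂ (Fin (d k))} (h : IsFrame α β)
    (k : Fin p) (z0 : ℂ) (z : Fin p → ℂ) :
    inner ℂ (productVec (Function.update α k (β k))) (wVec α β z0 z) = z k := by
  rw [inner_productVec_wVec_of_inner_eq_zero (k := k) (by simp [h.inner_right_left k])]
  rw [Finset.prod_eq_one, update_self, h.inner_self_right, mul_one, mul_one]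
  intro l hl
  rw [update_of_ne (ne_of_mem_erase hl), h.inner_self_left]

theorem IsFrame.norm_wVec_sq {α β : ∀ k, EuclideanSpace ℂ (Fin (d k))} (h : IsFrame α β)
    (z0 : ℂ) (z : Fin p → ℂ) : ‖wVec α β z0 z‖ ^ 2 = weight z0 z := by
  have h0 : inner ℂ (productVec α) (wVec α β z0 z) = z0 := by
    rw [inner_productVec_wVec]
    simp [h.norm_left, h.inner_left_right]
  have key : inner ℂ (wVec α β z0 z) (wVec α β z0 z) = (weight z0 z : ℂ) := by
    conv_lhs => arg 2; rw [wVec]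
    simp only [inner_add_left, sum_inner, inner_smul_left, h0, h.inner_update_wVec, weight]
    push_cast
    simp only [← Complex.conj_mul']
  rw [inner_self_eq_norm_sq_to_K] at key
  exact Complex.ofReal_injective (by simpa using key)

theorem weight_nonneg (z0 : ℂ) (z : Fin p → ℂ) : 0 ≤ weight z0 z := by
  unfold weight
  positivity

theorem smul_wVec (α β : ∀ k, EuclideanSpace ℂ (Fin (d k))) (c z0 : ℂ) (z : Fin p → ℂ) :
    c • wVec α β z0 z = wVec α β (c * z0) (c • z) := by
  simp [wVec, smul_add, Finset.smul_sum, smul_smul]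

/-! ### Local measurements as triangular blocks. -/

theorem exists_norm_eq_one_smul {E : Type*} [NormedAddCommGroup E] [InnerProductSpace ℂ E]
    [Nontrivial E] (v : E) : ∃ (e : E) (a : ℂ), ‖e‖ = 1 ∧ v = a • e := by
  by_cases hv : v = 0
  · obtain ⟨e, he⟩ := exists_norm_eq E (zero_le_one' ℝ)
    exact ⟨e, 0, he, by simp [hv]⟩
  · refine ⟨((‖v‖⁻¹ : ℝ) : ℂ) • v, (‖v‖ : ℂ), ?_, ?_⟩
    · simp [norm_smul, hv]
    · rw [smul_smul]
      have : (‖v‖ : ℂ) ≠ 0 := by simpa using hv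
      simp [this]

/-- In dimension at least two, every pair of vectors is triangular in some orthonormal pair. -/
theorem exists_orthonormal_pair_triangular {E : Type*} [NormedAddCommGroup E]
    [InnerProductSpace ℂ E] {f₁ f₂ : E} (hf : Orthonormal ℂ ![f₁, f₂]) (v w : E) :
    ∃ (e f : E) (a b c : ℂ), Orthonormal ℂ ![e, f] ∧ v = a • e ∧ w = b • e + c • f := by
  have hE : Nontrivial E := ⟨f₁, 0, hf.ne_zero 0⟩
  obtain ⟨e, a, he, hv⟩ := exists_norm_eq_one_smul v
  -- The given pair only ensures dimension at least two, so that a unit vector orthogonal to `e`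
  -- exists even if the remainder of `w` vanishes.
  have hF : Nontrivial (ℂ ∙ e)ᗮ := by
    rw [Submodule.nontrivial_iff_ne_bot]
    intro hbot
    have htop : (ℂ ∙ e) = ⊤ := (Submodule.orthogonal_eq_bot_iff).1 hbot
    obtain ⟨h11, h22, h12, h21⟩ := orthonormal_pair_iff.1 hf
    obtain ⟨r, hr⟩ := Submodule.mem_span_singleton.1 (htop ▸ Submodule.mem_top : f₁ ∈ (ℂ ∙ e))
    obtain ⟨s, hs⟩ := Submodule.mem_span_singleton.1 (htop ▸ Submodule.mem_top : f₂ ∈ (ℂ ∙ e))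
    rw [← hr, ← hs, inner_smul_left, inner_smul_right, inner_self_eq_norm_sq_to_K, he] at h12
    have hr0 : r ≠ 0 := by
      rintro rfl
      simp [← hr] at h11
    have hs0 : s ≠ 0 := by
      rintro rfl
      simp [← hs] at h22
    simp [hr0, hs0] at h12
  have hee : inner ℂ e e = 1 := by simp [inner_self_eq_norm_sq_to_K, he]
  have hw : w - (inner ℂ e w) • e ∈ (ℂ ∙ e)ᗮ := by
    rw [Submodule.mem_orthogonal_singleton_iff_inner_right, inner_sub_right, inner_smul_right, hee]
    simp
  obtain ⟨f, c, hf1, hc⟩ := exists_norm_eq_one_smul (⟨_, hw⟩ : (ℂ ∙ e)ᗮ)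
  have hef : inner ℂ e (f : E) = 0 := Submodule.mem_orthogonal_singleton_iff_inner_right.1 f.2
  refine ⟨e, f, a, inner ℂ e w, c, orthonormal_pair_iff.2 ⟨hee, ?_, hef, ?_⟩, hv, ?_⟩
  · have : ‖(f : E)‖ = 1 := hf1
    simp [inner_self_eq_norm_sq_to_K, this]
  · rw [← inner_conj_symm, hef, map_zero]
  · have := congrArg Subtype.val hc
    simp only [Submodule.coe_smul] at this
    rw [← this]
    abel

theorem sum_inner_toEuclideanLin {m n : ℕ} {M : Fin n → Matrix (Fin m) (Fin m) ℂ}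
    (hM : ∑ j, (M j)ᴴ * M j = 1) (v w : EuclideanSpace ℂ (Fin m)) :
    ∑ j, inner ℂ (Matrix.toEuclideanLin (M j) v) (Matrix.toEuclideanLin (M j) w) =
      inner ℂ v w := by
  have h : ∀ j, inner ℂ (Matrix.toEuclideanLin (M j) v) (Matrix.toEuclideanLin (M j) w) =
      inner ℂ v (Matrix.toEuclideanLin ((M j)ᴴ * M j) w) := by
    intro j
    rw [← LinearMap.adjoint_inner_right, ← Matrix.toEuclideanLin_conjTranspose_eq_adjoint]
    congr 1
    ext i
    simp [Matrix.toLpLin_apply, Matrix.mulVec_mulVec]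
  simp only [h, ← inner_sum, ← LinearMap.sum_apply, ← map_sum, hM]
  simp

/-- The triangular blocks `(a j, b j; 0, c j)` of the operators of a general measurement. -/
structure IsTriangularMeasurement {n : ℕ} (a b c : Fin n → ℂ) : Prop where
  sum_left : ∑ j, ‖a j‖ ^ 2 = 1
  sum_right : ∑ j, (‖b j‖ ^ 2 + ‖c j‖ ^ 2) = 1
  sum_cross : ∑ j, starRingEnd ℂ (a j) * b j = 0

/-- The effect of a local measurement on a vector in the normal form. -/
theorem IsFrame.exists_applyLocal_eq {α β : ∀ k, EuclideanSpace ℂ (Fin (d k))}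
    (h : IsFrame α β) (k : Fin p) {n : ℕ} {M : Fin n → Matrix (Fin (d k)) (Fin (d k)) ℂ}
    (hM : ∑ j, (M j)ᴴ * M j = 1) :
    ∃ (α' β' : Fin n → ∀ k, EuclideanSpace ℂ (Fin (d k))) (a b c : Fin n → ℂ),
      (∀ j, IsFrame (α' j) (β' j)) ∧ IsTriangularMeasurement a b c ∧
      ∀ j z0 z, applyLocal k (M j) (wVec α β z0 z) =
        wVec (α' j) (β' j) (a j * z0 + b j * z k) (Function.update (a j • z) k (c j * z k)) := by
  choose e f a b c hef ha hbc using fun j => exists_orthonormal_pair_triangular (h k)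
    (Matrix.toEuclideanLin (M j) (α k)) (Matrix.toEuclideanLin (M j) (β k))
  refine ⟨fun j => Function.update α k (e j), fun j => Function.update β k (f j), a, b, c,
    fun j => h.update k (hef j), ?_, fun j z0 z => applyLocal_wVec k (ha j) (hbc j) z0 z⟩
  have h1 := sum_inner_toEuclideanLin hM (α k) (α k)
  have h2 := sum_inner_toEuclideanLin hM (β k) (β k)
  have h3 := sum_inner_toEuclideanLin hM (α k) (β k)
  have i11 := fun j => (orthonormal_pair_iff.1 (hef j)).1
  have i22 := fun j => (orthonormal_pair_iff.1 (hef j)).2.1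
  have i12 := fun j => (orthonormal_pair_iff.1 (hef j)).2.2.1
  have i21 := fun j => (orthonormal_pair_iff.1 (hef j)).2.2.2
  simp only [ha, hbc, inner_add_left, inner_add_right, inner_smul_left, inner_smul_right, i11,
    i22, i12, i21, h.inner_self_left, h.inner_self_right, h.inner_left_right, mul_one, mul_zero,
    add_zero, zero_add] at h1 h2 h3
  refine ⟨?_, ?_, ?_⟩
  · rw [← Complex.ofReal_inj]
    push_cast
    rw [← h1]
    exact Finset.sum_congr rfl fun j _ => by rw [← Complex.conj_mul', mul_comm]
  · rw [← Complex.ofReal_inj]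
    push_cast
    rw [← h2]
    exact Finset.sum_congr rfl fun j _ => by
      rw [← Complex.conj_mul', ← Complex.conj_mul', mul_comm, mul_comm _ (c j)]
  · rw [← h3]
    exact Finset.sum_congr rfl fun j _ => by rw [mul_comm]

/-! ### Rigidity of the normal form. -/

/-- Exchange of two arguments in a product over all parties. -/
theorem prod_update_mul_prod_update {ι R : Type*} [DecidableEq ι] [CommMonoid R] {V : ι → Type*}
    (s : Finset ι) (h : ∀ l, V l → R) (u : ∀ l, V l) {i j : ι} (hij : i ≠ j) (v v' : V i)
    (w w' : V j) :
    (∏ l ∈ s, h l (update (update u i v) j w l)) *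
        ∏ l ∈ s, h l (update (update u i v') j w' l) =
      (∏ l ∈ s, h l (update (update u i v) j w' l)) *
        ∏ l ∈ s, h l (update (update u i v') j w l) := by
  rw [← Finset.prod_mul_distrib, ← Finset.prod_mul_distrib]
  refine Finset.prod_congr rfl fun l _ => ?_
  by_cases hj : l = j
  · subst hj
    simp [mul_comm]
  · by_cases hi : l = i
    · subst hi
      simp [hj]
    · simp [hi, hj]

/-- A vector orthogonal to `α k` in one normal form is orthogonal to `α' k` in any other one that
has two nonzero amplitudes at other parties. -/
theorem inner_eq_zero_of_wVec_eq {α β α' β' : ∀ k, EuclideanSpace ℂ (Fin (d k))}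
    (h' : IsFrame α' β') {z0 y0 : ℂ} {z y : Fin p → ℂ} (heq : wVec α β z0 z = wVec α' β' y0 y)
    {k i j : Fin p} (hik : i ≠ k) (hjk : j ≠ k) (hij : i ≠ j) (hi : y i ≠ 0) (hj : y j ≠ 0)
    {γ : EuclideanSpace ℂ (Fin (d k))} (hγ : inner ℂ γ (α k) = 0) :
    inner ℂ γ (α' k) = 0 := by
  set u : ∀ k, EuclideanSpace ℂ (Fin (d k)) := update α' k γ with hu
  have hk : ∀ v w, update (update u i v) j w k = γ := by
    intro v w
    simp [hu, hik.symm, hjk.symm]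
  -- Contracting party `k` with `γ ⊥ α k` leaves a product vector in the first form, so the 2×2
  -- minor of `F` in parties `i, j` vanishes. In the second form the entry at `β' i, β' j` is zero
  -- and the minor is `-(y i * y j) * ⟪γ, α' k⟫ ^ 2`.
  let F := fun v w => inner ℂ (productVec (update (update u i v) j w)) (wVec α β z0 z)
  have hF : ∀ v w, F v w = z k * (inner ℂ γ (β k) *
      ∏ l ∈ univ.erase k, inner ℂ (update (update u i v) j w l) (α l)) := by
    intro v w
    simp only [F]
    rw [inner_productVec_wVec_of_inner_eq_zero (k := k) (by rw [hk, hγ]), hk]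
  have hminor : F (β' i) (β' j) * F (α' i) (α' j) = F (β' i) (α' j) * F (α' i) (β' j) := by
    have := prod_update_mul_prod_update (univ.erase k)
      (fun l x => inner ℂ x (α l)) u hij (β' i) (α' i) (β' j) (α' j)
    simp only [hF]
    linear_combination (z k * inner ℂ γ (β k)) ^ 2 * this
  have hA : ∀ l, l ≠ k → l ≠ i → l ≠ j → ∀ v w,
      inner ℂ (update (update u i v) j w l) (α' l) = 1 := by
    intro l h1 h2 h3 v w
    simp [hu, h1, h2, h3, h'.norm_left]
  have hββ : F (β' i) (β' j) = 0 := by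
    simp only [F, heq]
    rw [inner_productVec_wVec_of_inner_eq_zero (k := i) (by simp [hij, h'.inner_right_left]),
      Finset.prod_eq_zero (i := j) (by simp [hij.symm]) (by simp [h'.inner_right_left])]
    simp
  have hβα : F (β' i) (α' j) = y i * inner ℂ γ (α' k) := by
    simp only [F, heq]
    rw [inner_productVec_wVec_of_inner_eq_zero (k := i) (by simp [hij, h'.inner_right_left]),
      Finset.prod_eq_single k _ (by simp [hik.symm]), hk]
    · simp [hij, h'.norm_right]
    · intro l hl hlk
      by_cases hlj : l = j
      · subst hlj
        simp [h'.norm_left]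
      · exact hA l hlk (ne_of_mem_erase hl) hlj _ _
  have hαβ : F (α' i) (β' j) = y j * inner ℂ γ (α' k) := by
    simp only [F, heq]
    rw [inner_productVec_wVec_of_inner_eq_zero (k := j) (by simp [h'.inner_right_left]),
      Finset.prod_eq_single k _ (by simp [hjk.symm]), hk]
    · simp [h'.norm_right]
    · intro l hl hlk
      by_cases hli : l = i
      · subst hli
        simp [hij, h'.norm_left]
      · exact hA l hlk hli (ne_of_mem_erase hl) _ _
  rw [hββ, hβα, hαβ, zero_mul] at hminor
  have : (y i * y j) * inner ℂ γ (α' k) ^ 2 = 0 := by linear_combination -hminor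
  simpa [hi, hj] using this

theorem prod_norm_inner_le_one (s : Finset (Fin p)) {u v : ∀ k, EuclideanSpace ℂ (Fin (d k))}
    (hu : ∀ k, ‖u k‖ = 1) (hv : ∀ k, ‖v k‖ = 1) : ‖∏ l ∈ s, inner ℂ (u l) (v l)‖ ≤ 1 := by
  rw [norm_prod]
  exact Finset.prod_le_one (fun _ _ => norm_nonneg _) fun l _ =>
    (norm_inner_le_norm _ _).trans (by simp [hu, hv])

/-- The amplitudes of a truly multipartite vector do not exceed, in absolute value, those of any
other normal form of the same vector. -/
theorem norm_le_norm_of_wVec_eq {α β α' β' : ∀ k, EuclideanSpace ℂ (Fin (d k))}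
    (h : IsFrame α β) (h' : IsFrame α' β') {z0 y0 : ℂ} {z y : Fin p → ℂ}
    (heq : wVec α β z0 z = wVec α' β' y0 y) {R : Finset (Fin p)} (hR : 3 ≤ R.card)
    (hy : ∀ k ∈ R, y k ≠ 0) (k : Fin p) : ‖y k‖ ≤ ‖z k‖ := by
  -- Three nonzero amplitudes are needed here: two must remain after `k` is removed.
  obtain ⟨i, hi, j, hj, hij⟩ : ∃ i ∈ R.erase k, ∃ j ∈ R.erase k, i ≠ j := by
    rw [← Finset.one_lt_card]
    have := Finset.pred_card_le_card_erase (s := R) (a := k)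
    omega
  have hort : ∀ γ : EuclideanSpace ℂ (Fin (d k)), inner ℂ γ (α k) = 0 → inner ℂ γ (α' k) = 0 :=
    fun γ => inner_eq_zero_of_wVec_eq h' heq (ne_of_mem_erase hi) (ne_of_mem_erase hj) hij
      (hy i (mem_of_mem_erase hi)) (hy j (mem_of_mem_erase hj))
  set c := inner ℂ (α k) (α' k) with hc
  have hα' : α' k = c • α k := by
    have h1 : inner ℂ (α' k - c • α k) (α k) = 0 := by
      rw [inner_sub_left, inner_smul_left, h.inner_self_left, hc, inner_conj_symm]
      simp
    have h2 := hort _ h1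
    rw [← sub_eq_zero, ← inner_self_eq_zero (𝕜 := ℂ), inner_sub_right, inner_smul_right, h1, h2]
    simp
  have hc0 : c ≠ 0 := by
    intro h0
    have := h'.norm_left k
    simp [hα', h0] at this
  have hβ' : inner ℂ (β' k) (α k) = 0 := by
    have := h'.inner_right_left k
    rw [hα', inner_smul_right] at this
    simpa [hc0] using this
  -- As `α' k` is parallel to `α k`, reading off `y k` in the other form gives `z k` times inner
  -- products of unit vectors.
  have hyk := h'.inner_update_wVec k y0 y
  rw [← heq, inner_productVec_wVec_of_inner_eq_zero (k := k) (by simpa using hβ')] at hyk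
  rw [← hyk, norm_mul, norm_mul]
  have hu : ∀ l, ‖update α' k (β' k) l‖ = 1 := by
    intro l
    by_cases hl : l = k
    · subst hl
      simp [h'.norm_right]
    · simp [hl, h'.norm_left]
  have h1 : ‖inner ℂ (update α' k (β' k) k) (β k)‖ ≤ 1 :=
    (norm_inner_le_norm _ _).trans (by simp [h.norm_right, h'.norm_right])
  exact mul_le_of_le_one_right (norm_nonneg _)
    (mul_le_one₀ h1 (norm_nonneg _) (prod_norm_inner_le_one _ hu h.norm_left))

/-! ### Truly multipartite states have three nonzero amplitudes. -/

theorem productVec_apply_mul (u : ∀ k, EuclideanSpace ℂ (Fin (d k))) (k : Fin p)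
    (i : ∀ k, Fin (d k)) (a : Fin (d k)) :
    productVec u i * u k a = u k (i k) * productVec u (update i k a) := by
  have h : ∀ i : ∀ k, Fin (d k), productVec u i = u k (i k) * ∏ l ∈ univ.erase k, u l (i l) := by
    intro i
    simpa using productVec_update_apply u k (u k) i
  have h' : ∏ l ∈ univ.erase k, u l (update i k a l) = ∏ l ∈ univ.erase k, u l (i l) :=
    Finset.prod_congr rfl fun l hl => by rw [update_of_ne (ne_of_mem_erase hl)]
  rw [h, h (update i k a), h', update_self]
  ring

/-- Without the `β k` term, every summand has the factor `α k` at party `k`. The other factor is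
read off at a basis index `a` where `α k` does not vanish. -/
theorem IsFrame.isProductAcross_singleton {α β : ∀ k, EuclideanSpace ℂ (Fin (d k))}
    (h : IsFrame α β) {z0 : ℂ} {z : Fin p → ℂ} {k : Fin p} (hk : z k = 0) :
    IsProductAcross (wVec α β z0 z) {k} := by
  obtain ⟨a, ha⟩ : ∃ a, α k a ≠ 0 := by
    by_contra! hcon
    have h0 : α k = 0 := by
      ext a
      simpa using hcon a
    simpa [h0] using h.norm_left k
  have key : ∀ i, wVec α β z0 z i * α k a = α k (i k) * wVec α β z0 z (Function.update i k a) := by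
    intro i
    simp only [wVec, PiLp.add_apply, PiLp.smul_apply, smul_eq_mul, WithLp.ofLp_sum,
      Finset.sum_apply, add_mul, mul_add, Finset.sum_mul, Finset.mul_sum]
    congr 1
    · linear_combination z0 * productVec_apply_mul α k i a
    · refine Finset.sum_congr rfl fun j _ => ?_
      by_cases hj : j = k
      · subst hj
        simp [hk]
      · have := productVec_apply_mul (Function.update α j (β j)) k i a
        rw [update_of_ne (Ne.symm hj)] at this
        linear_combination z j * this
  refine ⟨fun f => α k (f ⟨k, mem_singleton_self k⟩), fun g => wVec α β z0 z (fun l =>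
    if hl : l = k then hl ▸ a else g ⟨l, by simpa using hl⟩) / α k a, fun i => ?_⟩
  have hi : (fun l => if hl : l = k then hl ▸ a else i l) = Function.update i k a := by
    ext l
    by_cases hl : l = k
    · subst hl
      simp
    · simp [hl]
  beta_reduce
  rw [hi, mul_div_assoc', ← key, mul_div_cancel_right₀ _ ha]

/-- At least three amplitudes of a truly multipartite state are nonzero. -/
theorem exists_three_le_card_ne_zero {Θ : State d} {y : Fin p → ℝ} (hΘ : HasParam Θ y)
    (hy : TrulyMultipartite Θ) : ∃ R : Finset (Fin p), 3 ≤ R.card ∧ ∀ k ∈ R, y k ≠ 0 := by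
  obtain ⟨R, hR, hcut⟩ := hy
  obtain ⟨-, α, β, hfr, rfl⟩ := hΘ
  refine ⟨R, hR, fun k hk h0 => ?_⟩
  refine hcut {k} ⟨k, hk, mem_singleton_self k⟩ ?_
    (IsFrame.isProductAcross_singleton (α := α) (β := β) (z := fun k => (Real.sqrt (y k) : ℂ))
      hfr (by simp [h0]))
  obtain ⟨j, hj, hjk⟩ := Finset.exists_mem_ne (by omega : 1 < R.card) k
  exact ⟨j, hj, by simpa using hjk⟩

/-! ### From monotones to bounds on the success probability. -/

theorem zeroth_nonneg {x : Fin p → ℝ} (hx : x ∈ simplex p) : 0 ≤ zeroth x :=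
  sub_nonneg.2 hx.2

theorem weight_sqrt {x : Fin p → ℝ} (hx : x ∈ simplex p) :
    weight (Real.sqrt (zeroth x) : ℂ) (fun k => (Real.sqrt (x k) : ℂ)) = 1 := by
  have h := Real.sq_sqrt (zeroth_nonneg hx)
  simp only [weight, Complex.norm_real, Real.norm_eq_abs, sq_abs, h, Real.sq_sqrt (hx.1 _)]
  exact sub_add_cancel _ _

/-- Rigidity applied to the normalized vector and scaled back; this is all that the upper bounds use
about a successful branch. -/
theorem IsFrame.weight_mul_le {α β : ∀ k, EuclideanSpace ℂ (Fin (d k))} (h : IsFrame α β)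
    {y : Fin p → ℝ} {R : Finset (Fin p)} (hR : 3 ≤ R.card) (hy : ∀ k ∈ R, y k ≠ 0)
    {z0 : ℂ} {z : Fin p → ℂ}
    (hp : HasParam (((‖wVec α β z0 z‖⁻¹ : ℝ) : ℂ) • wVec α β z0 z) y) (k : Fin p) :
    weight z0 z * y k ≤ ‖z k‖ ^ 2 := by
  rw [← h.norm_wVec_sq]
  set N := ‖wVec α β z0 z‖ with hN
  obtain ⟨hs, α', β', h', heq⟩ := hp
  rw [smul_wVec] at heq
  have hle := norm_le_norm_of_wVec_eq (y := fun k => (Real.sqrt (y k) : ℂ)) h h' heq hR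
    (fun k hk => by simpa [Real.sqrt_eq_zero (hs.1 k)] using hy k hk) k
  have hle2 := pow_le_pow_left₀ (norm_nonneg _) hle 2
  have hy2 : ‖(Real.sqrt (y k) : ℂ)‖ ^ 2 = y k := by simp [Real.sq_sqrt (hs.1 k)]
  have hz2 : ‖(((N⁻¹ : ℝ) : ℂ) • z) k‖ ^ 2 = (N ^ 2)⁻¹ * ‖z k‖ ^ 2 := by
    simp [mul_pow]
  rw [hy2, hz2] at hle2
  by_cases h0 : N = 0
  · simp [h0]
  · have : 0 < N ^ 2 := by positivity
    rwa [inv_mul_eq_div, le_div_iff₀ this, mul_comm] at hle2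

/-- A function of the amplitudes that does not increase on average under local measurements and
dominates the weight of the target states bounds the success probability. -/
theorem successProb_wVec_le (f : ℂ → (Fin p → ℂ) → ℝ) {C : ℝ} {y : Fin p → ℝ}
    {R : Finset (Fin p)} (hR : 3 ≤ R.card) (hy : ∀ k ∈ R, y k ≠ 0)
    (hf : ∀ z0 z, 0 ≤ f z0 z)
    (hhalt : ∀ z0 z, (∀ k, weight z0 z * y k ≤ ‖z k‖ ^ 2) → C * weight z0 z ≤ f z0 z)
    (hstep : ∀ (k : Fin p) (n : ℕ) (a b c : Fin n → ℂ), IsTriangularMeasurement a b c →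
      ∀ z0 z, ∑ j, f (a j * z0 + b j * z k) (update (a j • z) k (c j * z k)) ≤ f z0 z)
    (T : Protocol d) {α β : ∀ k, EuclideanSpace ℂ (Fin (d k))} (h : IsFrame α β) (z0 : ℂ)
    (z : Fin p → ℂ) : C * successProb y T (wVec α β z0 z) ≤ f z0 z := by
  induction T generalizing α β z0 z with
  | halt =>
    rw [successProb]
    split_ifs with hp
    · rw [h.norm_wVec_sq]
      exact hhalt _ _ (h.weight_mul_le hR hy hp)
    · simpa using hf z0 z
  | measure k n M hM next ih =>
    obtain ⟨α', β', a, b, c, hfr, habc, happ⟩ := h.exists_applyLocal_eq k hM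
    rw [successProb, Finset.mul_sum]
    refine le_trans (Finset.sum_le_sum fun j _ => ?_) (hstep k n a b c habc z0 z)
    rw [happ]
    exact ih j (hfr j) _ _

/-! ### The weight and the single components as monotones. -/

theorem norm_mul_add_mul_sq (a b z w : ℂ) : ‖a * z + b * w‖ ^ 2 =
    ‖a‖ ^ 2 * ‖z‖ ^ 2 + ‖b‖ ^ 2 * ‖w‖ ^ 2 +
      2 * (starRingEnd ℂ a * b * (starRingEnd ℂ z * w)).re := by
  simp only [Complex.sq_norm, Complex.normSq_apply, Complex.add_re, Complex.add_im,
    Complex.mul_re, Complex.mul_im, Complex.conj_re, Complex.conj_im]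
  ring

/-- The total weight of the amplitudes of the parties other than `k`. -/
def restWeight (k : Fin p) (z : Fin p → ℂ) : ℝ :=
  ∑ l ∈ univ.erase k, ‖z l‖ ^ 2

theorem weight_eq (k : Fin p) (z0 : ℂ) (z : Fin p → ℂ) :
    weight z0 z = ‖z0‖ ^ 2 + ‖z k‖ ^ 2 + restWeight k z := by
  rw [weight, restWeight, ← Finset.add_sum_erase _ _ (mem_univ k)]
  ring

theorem restWeight_update (k : Fin p) (z : Fin p → ℂ) (a w : ℂ) :
    restWeight k (update (a • z) k w) = ‖a‖ ^ 2 * restWeight k z := by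
  rw [restWeight, restWeight, Finset.mul_sum]
  refine Finset.sum_congr rfl fun l hl => ?_
  rw [update_of_ne (ne_of_mem_erase hl)]
  simp [mul_pow]

theorem IsTriangularMeasurement.sum_cross_mul {n : ℕ} {a b c : Fin n → ℂ}
    (h : IsTriangularMeasurement a b c) (w : ℂ) :
    ∑ j, (starRingEnd ℂ (a j) * b j * w).re = 0 := by
  rw [← Complex.re_sum, ← Finset.sum_mul, h.sum_cross]
  simp

theorem IsTriangularMeasurement.sum_weight {n : ℕ} {a b c : Fin n → ℂ}
    (h : IsTriangularMeasurement a b c) (k : Fin p) (z0 : ℂ) (z : Fin p → ℂ) :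
    ∑ j, weight (a j * z0 + b j * z k) (update (a j • z) k (c j * z k)) = weight z0 z := by
  simp only [weight_eq k, restWeight_update, update_self, norm_mul_add_mul_sq, norm_mul, mul_pow]
  have : ∀ j, ‖a j‖ ^ 2 * ‖z0‖ ^ 2 + ‖b j‖ ^ 2 * ‖z k‖ ^ 2 +
      2 * (starRingEnd ℂ (a j) * b j * (starRingEnd ℂ z0 * z k)).re +
      ‖c j‖ ^ 2 * ‖z k‖ ^ 2 + ‖a j‖ ^ 2 * restWeight k z =
      ‖a j‖ ^ 2 * (‖z0‖ ^ 2 + restWeight k z) + (‖b j‖ ^ 2 + ‖c j‖ ^ 2) * ‖z k‖ ^ 2 +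
      2 * (starRingEnd ℂ (a j) * b j * (starRingEnd ℂ z0 * z k)).re := fun j => by ring
  simp only [this, Finset.sum_add_distrib, ← Finset.sum_mul, ← Finset.mul_sum, h.sum_left,
    h.sum_cross_mul]
  rw [← Finset.sum_add_distrib, h.sum_right]
  ring

theorem IsTriangularMeasurement.sum_component_le {n : ℕ} {a b c : Fin n → ℂ}
    (h : IsTriangularMeasurement a b c) (k i : Fin p) (z : Fin p → ℂ) :
    ∑ j, ‖update (a j • z) k (c j * z k) i‖ ^ 2 ≤ ‖z i‖ ^ 2 := by
  by_cases hi : i = k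
  · subst hi
    simp only [update_self, norm_mul, mul_pow, ← Finset.sum_mul]
    refine mul_le_of_le_one_left (by positivity) (h.sum_right ▸ Finset.sum_le_sum fun j _ => ?_)
    exact le_add_of_nonneg_left (by positivity)
  · simp [hi, mul_pow, ← Finset.sum_mul, h.sum_left]

/-! ### The second elementary symmetric polynomial over the weight as a monotone. -/

/-- Twice the second elementary symmetric polynomial. -/
def pairSum (u : Fin p → ℝ) : ℝ :=
  (∑ k, u k) ^ 2 - ∑ k, u k ^ 2

/-- Twice the second elementary symmetric polynomial of the components other than `k`. -/
def restPairSum (k : Fin p) (u : Fin p → ℝ) : ℝ :=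
  (∑ l ∈ univ.erase k, u l) ^ 2 - ∑ l ∈ univ.erase k, u l ^ 2

theorem pairSum_eq (k : Fin p) (u : Fin p → ℝ) :
    pairSum u = 2 * u k * (∑ l ∈ univ.erase k, u l) + restPairSum k u := by
  rw [pairSum, restPairSum, ← Finset.add_sum_erase _ _ (mem_univ k),
    ← Finset.add_sum_erase _ (fun l => u l ^ 2) (mem_univ k)]
  ring

theorem pairSum_eq_sum (u : Fin p → ℝ) : pairSum u = ∑ k, u k * ∑ l ∈ univ.erase k, u l := by
  rw [pairSum, sq, Finset.sum_mul, ← Finset.sum_sub_distrib]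
  refine Finset.sum_congr rfl fun k _ => ?_
  rw [← Finset.add_sum_erase _ _ (mem_univ k)]
  ring

theorem pairSum_mono {u v : Fin p → ℝ} (hu : ∀ k, 0 ≤ u k) (huv : ∀ k, u k ≤ v k) :
    pairSum u ≤ pairSum v := by
  rw [pairSum_eq_sum, pairSum_eq_sum]
  refine Finset.sum_le_sum fun k _ => mul_le_mul (huv k) (Finset.sum_le_sum fun l _ => huv l)
    (Finset.sum_nonneg fun l _ => hu l) ((hu k).trans (huv k))

theorem pairSum_nonneg {u : Fin p → ℝ} (hu : ∀ k, 0 ≤ u k) : 0 ≤ pairSum u := by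
  rw [pairSum_eq_sum]
  exact Finset.sum_nonneg fun k _ => mul_nonneg (hu k) (Finset.sum_nonneg fun l _ => hu l)

theorem pairSum_smul (t : ℝ) (u : Fin p → ℝ) : pairSum (t • u) = t ^ 2 * pairSum u := by
  simp only [pairSum, Pi.smul_apply, smul_eq_mul, ← Finset.mul_sum, mul_pow]
  ring

theorem pairSum_pos {u : Fin p → ℝ} (hu : ∀ k, 0 ≤ u k) {i j : Fin p} (hij : i ≠ j)
    (hi : u i ≠ 0) (hj : u j ≠ 0) : 0 < pairSum u := by
  rw [pairSum_eq_sum]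
  refine Finset.sum_pos' (fun k _ => mul_nonneg (hu k) (Finset.sum_nonneg fun l _ => hu l))
    ⟨i, mem_univ i, mul_pos ((hu i).lt_of_ne' hi) ?_⟩
  exact Finset.sum_pos' (fun l _ => hu l)
    ⟨j, mem_erase.2 ⟨hij.symm, mem_univ j⟩, (hu j).lt_of_ne' hj⟩

theorem restPairSum_le (k : Fin p) (u : Fin p → ℝ) :
    restPairSum k u ≤ (∑ l ∈ univ.erase k, u l) ^ 2 :=
  sub_le_self _ (Finset.sum_nonneg fun _ _ => sq_nonneg _)

theorem restPairSum_nonneg (k : Fin p) {u : Fin p → ℝ} (hu : ∀ k, 0 ≤ u k) :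
    0 ≤ restPairSum k u :=
  sub_nonneg.2 (Finset.sum_sq_le_sq_sum_of_nonneg fun l _ => hu l)

/-- The tangent bound behind the monotonicity of `pairSum / weight`. -/
theorem div_le_tangent {A W C s q Y v r : ℝ} (hA : 0 ≤ A) (hW : 0 ≤ W) (hC : 0 ≤ C) (hs : 0 ≤ s)
    (hq : 0 ≤ q) (hqs : q ≤ s ^ 2) (hY : ∀ t, 0 ≤ A * W - 2 * t * Y + t ^ 2 * v)
    (hAY : A = 0 → Y = 0) :
    (2 * C * (A * s) + A ^ 2 * q) / (W + C + A * s) ≤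
      2 * A * s - 2 * s * (2 * r * Y - r ^ 2 * v * (W + C + A * s)) -
        (2 * s ^ 2 - q) * (2 * r * A - r ^ 2 * (W + C + A * s)) := by
  have hAs := mul_nonneg hA hs
  -- If the weight vanishes, the quotient is `0` by convention, and the right side is `0` as well.
  rcases (add_nonneg (add_nonneg hW hC) hAs).eq_or_lt with hT | hT
  · have h1 : A * s = 0 := by linarith
    rw [← hT]
    rcases mul_eq_zero.1 h1 with h | h
    · simp [h, hAY h]
    · have : q = 0 := by nlinarith
      simp [h, this]
  · rw [div_le_iff₀ hT]
    -- With `T = W + C + A * s`, the numerator is `2AsT - 2sAW - (2s² - q)A²`. The terms `AW / T`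
    -- and `A² / T` are bounded below by tangents of slope parameter `r`, which for `AW / T` means
    -- `t = r * T` in `hY`.
    have h1 := mul_nonneg hs (hY (r * (W + C + A * s)))
    have h2 : 0 ≤ (2 * s ^ 2 - q) * (A - r * (W + C + A * s)) ^ 2 :=
      mul_nonneg (by nlinarith) (sq_nonneg _)
    linarith

/-- Convexity of `‖v‖ ^ 2 / T` in `(v, T)`: the tangent bounds at `r = τ⁻¹` are linear in `‖a j‖ ^
2`, `Y j` and `T j`, whose sums over the outcomes are `1`, `‖z0‖ ^ 2` and `τ`. -/
theorem IsTriangularMeasurement.sum_pairSum_div_weight_le {n : ℕ} {a b c : Fin n → ℂ}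
    (h : IsTriangularMeasurement a b c) (k : Fin p) (z0 : ℂ) (z : Fin p → ℂ) :
    ∑ j, pairSum (fun l => ‖update (a j • z) k (c j * z k) l‖ ^ 2) /
        weight (a j * z0 + b j * z k) (update (a j • z) k (c j * z k)) ≤
      pairSum (fun l => ‖z l‖ ^ 2) / weight z0 z := by
  set s := restWeight k z with hs
  set q := restPairSum k (fun l => ‖z l‖ ^ 2) with hq
  set τ := weight z0 z with hτ
  set Y : Fin n → ℝ := fun j => ‖a j‖ ^ 2 * ‖z0‖ ^ 2 +
    (starRingEnd ℂ (a j) * b j * (starRingEnd ℂ z0 * z k)).re with hY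
  set T : Fin n → ℝ := fun j => weight (a j * z0 + b j * z k) (update (a j • z) k (c j * z k))
    with hT
  have hs0 : 0 ≤ s := Finset.sum_nonneg fun l _ => by positivity
  have hpair : ∀ j, pairSum (fun l => ‖update (a j • z) k (c j * z k) l‖ ^ 2) =
      2 * ‖c j * z k‖ ^ 2 * (‖a j‖ ^ 2 * s) + (‖a j‖ ^ 2) ^ 2 * q := by
    intro j
    rw [pairSum_eq k, update_self]
    congr 1
    · congr 1
      exact restWeight_update k z (a j) _
    · simp only [hq, restPairSum, mul_sub]
      congr 1
      · rw [← mul_pow]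
        congr 1
        exact restWeight_update k z (a j) _
      · rw [Finset.mul_sum]
        refine Finset.sum_congr rfl fun l hl => ?_
        rw [update_of_ne (ne_of_mem_erase hl)]
        simp [mul_pow]
  have hTj : ∀ j, T j = ‖a j * z0 + b j * z k‖ ^ 2 + ‖c j * z k‖ ^ 2 + ‖a j‖ ^ 2 * s := by
    intro j
    simp only [hT]
    rw [weight_eq k, update_self, restWeight_update]
  have hbound : ∀ j, pairSum (fun l => ‖update (a j • z) k (c j * z k) l‖ ^ 2) / T j ≤
      2 * ‖a j‖ ^ 2 * s - 2 * s * (2 * τ⁻¹ * Y j - τ⁻¹ ^ 2 * ‖z0‖ ^ 2 * T j) -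
        (2 * s ^ 2 - q) * (2 * τ⁻¹ * ‖a j‖ ^ 2 - τ⁻¹ ^ 2 * T j) := by
    intro j
    rw [hpair, hTj]
    refine div_le_tangent (by positivity) (by positivity) (by positivity) hs0
      (restPairSum_nonneg k fun l => by positivity) (restPairSum_le k _) (fun t => ?_)
      fun h0 => ?_
    -- `Y j` is the real part of the inner product of `conj (a j) * (a j * z0 + b j * z k)` with
    -- `z0`, so the quadratic in `t` is a squared norm.
    · have : ‖a j‖ ^ 2 * ‖a j * z0 + b j * z k‖ ^ 2 - 2 * t * Y j + t ^ 2 * ‖z0‖ ^ 2 =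
          ‖starRingEnd ℂ (a j) * (a j * z0 + b j * z k) - t * z0‖ ^ 2 := by
        simp only [hY, Complex.sq_norm, Complex.normSq_apply, Complex.add_re, Complex.add_im,
          Complex.mul_re, Complex.mul_im, Complex.conj_re, Complex.conj_im, Complex.sub_re,
          Complex.sub_im, Complex.ofReal_re, Complex.ofReal_im]
        ring
      rw [this]
      positivity
    · have : a j = 0 := by simpa using h0
      simp [hY, this]
  refine (Finset.sum_le_sum fun j _ => hbound j).trans (le_of_eq ?_)
  have hYsum : ∑ j, Y j = ‖z0‖ ^ 2 := by
    simp only [hY, Finset.sum_add_distrib, ← Finset.sum_mul, h.sum_left, h.sum_cross_mul]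
    ring
  have hTsum : ∑ j, T j = τ := h.sum_weight k z0 z
  simp only [Finset.sum_sub_distrib, ← Finset.mul_sum, ← Finset.sum_mul, hYsum, hTsum,
    h.sum_left]
  have hpz : pairSum (fun l => ‖z l‖ ^ 2) = 2 * ‖z k‖ ^ 2 * s + q := pairSum_eq k _
  have hτk : τ = ‖z0‖ ^ 2 + ‖z k‖ ^ 2 + s := weight_eq k z0 z
  rw [hpz]
  by_cases h0 : τ = 0
  · have : s = 0 := by nlinarith [sq_nonneg ‖z0‖, sq_nonneg ‖z k‖]
    simp [h0, this]
  · field_simp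
    rw [hτk]
    ring

/-! ### The upper bounds `pBnd x y` and `t ^ 2`. -/

theorem pBnd_nonneg {x y : Fin p → ℝ} (hx : ∀ k, 0 ≤ x k) (hy : ∀ k, 0 ≤ y k) :
    0 ≤ pBnd x y :=
  (Finset.le_fold_min _).2 ⟨zero_le_one, fun k _ => div_nonneg (hx k) (hy k)⟩

theorem pBnd_mul_le {x y : Fin p → ℝ} (hx : ∀ k, 0 ≤ x k) (hy : ∀ k, 0 ≤ y k) (k : Fin p) :
    pBnd x y * y k ≤ x k := by
  by_cases h0 : y k = 0
  · simpa [h0] using hx k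
  · rw [← le_div_iff₀ ((hy k).lt_of_ne' h0)]
    exact ((Finset.le_fold_min _).1 le_rfl).2 k (by simpa using h0)

theorem pBnd_smul {t : ℝ} (ht : t ≤ 1) {y : Fin p → ℝ} {k : Fin p} (hk : y k ≠ 0) :
    pBnd (t • y) y = t := by
  refine le_antisymm ?_ ?_
  · have := ((Finset.le_fold_min (pBnd (t • y) y)).1 le_rfl).2 k (by simpa using hk)
    simpa [hk] using this
  · refine (Finset.le_fold_min _).2 ⟨ht, fun j hj => ?_⟩
    have : y j ≠ 0 := by simpa using hj
    simp [this]

/-- The success probability is bounded by every ratio `x k / y k` and by one. -/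
theorem successProb_le_pBnd {x y : Fin p → ℝ} {Ψ : State d} (hΨ : HasParam Ψ x)
    (hy0 : ∀ k, 0 ≤ y k) {R : Finset (Fin p)} (hR : 3 ≤ R.card) (hy : ∀ k ∈ R, y k ≠ 0)
    (T : Protocol d) : successProb y T Ψ ≤ pBnd x y := by
  obtain ⟨hx, α, β, hfr, rfl⟩ := hΨ
  refine (Finset.le_fold_min _).2 ⟨?_, fun k hk => ?_⟩
  · have := successProb_wVec_le (d := d) weight (C := 1) hR hy weight_nonneg
      (fun z0 z _ => (one_mul _).le) (fun k n a b c h z0 z => (h.sum_weight k z0 z).le) T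
      (α := α) (β := β) hfr (Real.sqrt (zeroth x) : ℂ) (fun k => (Real.sqrt (x k) : ℂ))
    rw [weight_sqrt hx, one_mul] at this
    exact this
  · have hk0 : y k ≠ 0 := by simpa using hk
    rw [le_div_iff₀ ((hy0 k).lt_of_ne' hk0)]
    have := successProb_wVec_le (d := d) (fun _ z => ‖z k‖ ^ 2) (C := y k) hR hy
      (fun _ _ => sq_nonneg _) (fun z0 z h => by simpa [mul_comm] using h k)
      (fun i n a b c h _ z => h.sum_component_le i k z) T
      (α := α) (β := β) hfr (Real.sqrt (zeroth x) : ℂ) (fun k => (Real.sqrt (x k) : ℂ))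
    simp only [Complex.norm_real, Real.norm_eq_abs, sq_abs, Real.sq_sqrt (hx.1 k)] at this
    rw [mul_comm]
    exact this

/-- From `t • y` the target `y` is reached with probability at most `t ^ 2`. -/
theorem successProb_smul_le {t : ℝ} {y : Fin p → ℝ} {Ψ : State d} (hΨ : HasParam Ψ (t • y))
    (hy0 : ∀ k, 0 ≤ y k) {R : Finset (Fin p)} (hR : 3 ≤ R.card) (hy : ∀ k ∈ R, y k ≠ 0)
    (T : Protocol d) : successProb y T Ψ ≤ t ^ 2 := by
  obtain ⟨hx, α, β, hfr, rfl⟩ := hΨ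
  obtain ⟨i, hi, j, hj, hij⟩ := Finset.one_lt_card.1 (by omega : 1 < R.card)
  have hpos := pairSum_pos hy0 hij (hy i hi) (hy j hj)
  have := successProb_wVec_le (d := d)
    (fun z0 z => pairSum (fun l => ‖z l‖ ^ 2) / weight z0 z) (C := pairSum y) hR hy
    (fun z0 z => div_nonneg (pairSum_nonneg fun l => by positivity) (weight_nonneg z0 z))
    (fun z0 z h => by
      rcases (weight_nonneg z0 z).eq_or_lt with h0 | h0
      · simp [← h0]
      · rw [le_div_iff₀ h0]
        -- On success the squared amplitudes dominate `weight z0 z • y`, and `pairSum` is monotone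
        -- and homogeneous of degree two.
        refine le_trans (le_of_eq ?_) (pairSum_mono (u := weight z0 z • y)
          (fun k => mul_nonneg h0.le (hy0 k)) h)
        rw [pairSum_smul]
        ring)
    (fun k n a b c h z0 z => h.sum_pairSum_div_weight_le k z0 z) T (α := α) (β := β) hfr
    (Real.sqrt (zeroth (t • y)) : ℂ) (fun k => (Real.sqrt ((t • y) k) : ℂ))
  rw [weight_sqrt hx, div_one] at this
  have hsq : (fun l => ‖(Real.sqrt ((t • y) l) : ℂ)‖ ^ 2) = t • y := by
    ext l
    simp only [Complex.norm_real, Real.norm_eq_abs, sq_abs, Real.sq_sqrt (hx.1 l)]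
  rw [hsq, pairSum_smul, mul_comm (t ^ 2)] at this
  exact le_of_mul_le_mul_left this hpos

/-! ### Attaining the bound by sequential damping. -/

/-- The rank-one matrix `|v⟩⟨v|`. -/
def ketBra {m : ℕ} (v : EuclideanSpace ℂ (Fin m)) : Matrix (Fin m) (Fin m) ℂ :=
  Matrix.vecMulVec v (star v.ofLp)

theorem toEuclideanLin_ketBra {m : ℕ} (v w : EuclideanSpace ℂ (Fin m)) :
    Matrix.toEuclideanLin (ketBra v) w = inner ℂ v w • v := by
  ext i
  simp [Matrix.toLpLin_apply, ketBra, Matrix.vecMulVec_mulVec,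
    EuclideanSpace.inner_eq_star_dotProduct, dotProduct_comm, mul_comm]

theorem conjTranspose_ketBra {m : ℕ} (v : EuclideanSpace ℂ (Fin m)) :
    (ketBra v)ᴴ = ketBra v := by
  simp [ketBra, Matrix.conjTranspose_vecMulVec]

theorem ketBra_mul_self {m : ℕ} {v : EuclideanSpace ℂ (Fin m)} (hv : ‖v‖ = 1) :
    ketBra v * ketBra v = ketBra v := by
  have h : star v.ofLp ⬝ᵥ v.ofLp = 1 := by
    rw [dotProduct_comm, ← EuclideanSpace.inner_eq_star_dotProduct, inner_self_eq_norm_sq_to_K, hv]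
    simp
  rw [ketBra, Matrix.vecMulVec_mul_vecMulVec, h, one_smul]

/-- The two-outcome measurement that damps the vector `v` by the factor `s`; outcome `0` is the
failure. -/
def dampMeasurement {m : ℕ} (v : EuclideanSpace ℂ (Fin m)) (s : ℝ) :
    Fin 2 → Matrix (Fin m) (Fin m) ℂ :=
  ![((Real.sqrt (1 - s ^ 2) : ℝ) : ℂ) • ketBra v, 1 - ((1 - s : ℝ) : ℂ) • ketBra v]

theorem sum_dampMeasurement {m : ℕ} {v : EuclideanSpace ℂ (Fin m)} (hv : ‖v‖ = 1) {s : ℝ}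
    (hs : s ^ 2 ≤ 1) : ∑ j, (dampMeasurement v s j)ᴴ * dampMeasurement v s j = 1 := by
  have h : ((Real.sqrt (1 - s ^ 2) : ℝ) : ℂ) * ((Real.sqrt (1 - s ^ 2) : ℝ) : ℂ) =
      1 - (s : ℂ) ^ 2 := by
    rw [← Complex.ofReal_mul, Real.mul_self_sqrt (by linarith)]
    push_cast
    rfl
  simp only [Fin.sum_univ_two, dampMeasurement, Matrix.cons_val_zero, Matrix.cons_val_one,
    Matrix.conjTranspose_smul, Matrix.conjTranspose_sub, Matrix.conjTranspose_one,
    conjTranspose_ketBra, Complex.star_def, Complex.conj_ofReal, sub_mul, mul_sub, one_mul,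
    mul_one, smul_mul_assoc, mul_smul_comm, ketBra_mul_self hv, smul_smul, h]
  push_cast
  module

/-- A vector with a single nonzero `β`-amplitude cannot reach the target: some `j ≠ k` in `R` has `z
j = 0` but `y j > 0`, which forces zero weight. This disposes of the failure branches. -/
theorem successProb_halt_eq_zero {y : Fin p → ℝ} {R : Finset (Fin p)} (hR : 3 ≤ R.card)
    (hy0 : ∀ k, 0 ≤ y k) (hy : ∀ k ∈ R, y k ≠ 0) {α β : ∀ k, EuclideanSpace ℂ (Fin (d k))}
    (h : IsFrame α β) {z0 : ℂ} {z : Fin p → ℂ} {k : Fin p} (hz : ∀ j, j ≠ k → z j = 0) :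
    successProb y .halt (wVec α β z0 z) = 0 := by
  rw [successProb]
  split_ifs with hp
  · obtain ⟨j, hj, hjk⟩ := Finset.exists_mem_ne (by omega : 1 < R.card) k
    have := h.weight_mul_le hR hy hp j
    rw [hz j hjk, norm_zero, zero_pow two_ne_zero] at this
    have hyj := (hy0 j).lt_of_ne' (hy j hj)
    rw [h.norm_wVec_sq]
    refine le_antisymm ?_ (weight_nonneg z0 z)
    by_contra! hw
    exact (mul_pos hw hyj).not_ge this
  · rfl

/-- Parties acting one after the other can damp their amplitudes by prescribed factors. -/
theorem exists_sequential_damping {y : Fin p → ℝ} {R : Finset (Fin p)} (hR : 3 ≤ R.card)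
    (hy0 : ∀ k, 0 ≤ y k) (hy : ∀ k ∈ R, y k ≠ 0) {α β : ∀ k, EuclideanSpace ℂ (Fin (d k))}
    (h : IsFrame α β) (s : Fin p → ℝ) (l : List (Fin p)) (hl : l.Nodup)
    (hs : ∀ k ∈ l, s k ^ 2 ≤ 1) (z : Fin p → ℂ) :
    ∃ T : Protocol d, IsSequentialTwoOutcome l T ∧ successProb y T (wVec α β 0 z) =
      successProb y .halt (wVec α β 0 fun k => if k ∈ l then s k * z k else z k) := by
  induction l generalizing z with
  | nil => exact ⟨.halt, .nil, by simp⟩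
  | cons k l ih =>
    obtain ⟨hkl, hl'⟩ := List.nodup_cons.1 hl
    obtain ⟨T, hT, hP⟩ := ih hl' (fun j hj => hs j (List.mem_cons_of_mem _ hj))
      (Function.update z k (s k * z k))
    refine ⟨.measure k 2 (dampMeasurement (β k) (s k))
      (sum_dampMeasurement (h.norm_right k) (hs k List.mem_cons_self)) ![.halt, T],
      .cons _ _ _ _ _ rfl hT, ?_⟩
    have h0 : applyLocal k (dampMeasurement (β k) (s k) 0) (wVec α β 0 z) =
        wVec α β 0 (Function.update 0 k (((Real.sqrt (1 - s k ^ 2) : ℝ) : ℂ) * z k)) := by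
      rw [applyLocal_wVec (α' := α k) (β' := β k) (a := 0) (b := 0)
        (c := ((Real.sqrt (1 - s k ^ 2) : ℝ) : ℂ)) k]
      · simp
      · simp [dampMeasurement, -Complex.coe_smul, toEuclideanLin_ketBra, h.inner_right_left]
      · simp [dampMeasurement, -Complex.coe_smul, toEuclideanLin_ketBra, h.norm_right]
    have h1 : applyLocal k (dampMeasurement (β k) (s k) 1) (wVec α β 0 z) =
        wVec α β 0 (Function.update z k (s k * z k)) := by
      rw [applyLocal_wVec (α' := α k) (β' := β k) (a := 1) (b := 0) (c := (s k : ℂ)) k]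
      · simp
      · simp [dampMeasurement, -Complex.coe_smul, toEuclideanLin_ketBra, h.inner_right_left]
      · simp [dampMeasurement, -Complex.coe_smul, toEuclideanLin_ketBra, h.norm_right, sub_smul]
    change ∑ j : Fin 2, successProb y (![Protocol.halt, T] j)
      (applyLocal k (dampMeasurement (β k) (s k) j) (wVec α β 0 z)) = _
    rw [Fin.sum_univ_two, h0, h1, Matrix.cons_val_zero, Matrix.cons_val_one,
      Matrix.cons_val_zero, successProb_halt_eq_zero hR hy0 hy h (k := k)
        (fun j hj => by simp [hj]), zero_add, hP]
    congr 2
    ext j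
    by_cases hj : j = k
    · subst hj
      simp [hkl]
    · simp [hj]

theorem successProb_halt_smul {y : Fin p → ℝ} {Θ : State d} (hΘ : HasParam Θ y) {c : ℝ}
    (hc : 0 ≤ c) : successProb y .halt ((c : ℂ) • Θ) = c ^ 2 := by
  have hn : ‖Θ‖ = 1 := by
    obtain ⟨hy, α, β, hfr, rfl⟩ := hΘ
    have := IsFrame.norm_wVec_sq (α := α) (β := β) hfr (Real.sqrt (zeroth y) : ℂ)
      (fun k => (Real.sqrt (y k) : ℂ))
    rw [weight_sqrt hy] at this
    exact (pow_eq_one_iff_of_nonneg (norm_nonneg _) two_ne_zero).1 this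
  have hnc : ‖(c : ℂ) • Θ‖ = c := by simp [norm_smul, hn, abs_of_nonneg hc]
  rcases hc.eq_or_lt with rfl | hc
  · simp [successProb]
  · rw [successProb, hnc, if_pos]
    rw [smul_smul, ← Complex.ofReal_mul, inv_mul_cancel₀ hc.ne']
    simpa using hΘ

/-- For states without the component `α₁ ⊗ ⋯ ⊗ α_p`, sequential damping attains the bound. -/
theorem exists_sequential_successProb_eq {x y : Fin p → ℝ} {Ψ : State d} (hΨ : HasParam Ψ x)
    (hys : y ∈ simplex p) {R : Finset (Fin p)} (hR : 3 ≤ R.card) (hy : ∀ k ∈ R, y k ≠ 0)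
    (hx0 : zeroth x = 0) (hy0 : zeroth y = 0) (l : List (Fin p)) (hl : l.Nodup)
    (hmem : ∀ k, k ∈ l ↔ pBnd x y * y k < x k) :
    ∃ T : Protocol d, IsSequentialTwoOutcome l T ∧ successProb y T Ψ = pBnd x y := by
  obtain ⟨hx, α, β, hfr, rfl⟩ := hΨ
  set P := pBnd x y with hP
  have hP0 : 0 ≤ P := pBnd_nonneg hx.1 hys.1
  have hle : ∀ k, P * y k ≤ x k := pBnd_mul_le hx.1 hys.1
  have hPy : ∀ k, 0 ≤ P * y k := fun k => mul_nonneg hP0 (hys.1 k)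
  -- The factor `√(P * y k / x k)` lowers the squared amplitude from `x k` to `P * y k`; parties
  -- outside `l` already have `x k = P * y k`.
  obtain ⟨T, hT, hTP⟩ := exists_sequential_damping hR hys.1 hy (α := α) (β := β) hfr
    (fun k => Real.sqrt (P * y k / x k)) l hl (fun k _ => by
      rw [Real.sq_sqrt (div_nonneg (hPy k) (hx.1 k))]
      exact div_le_one_of_le₀ (hle k) (hx.1 k)) (fun k => (Real.sqrt (x k) : ℂ))
  refine ⟨T, hT, ?_⟩
  have hΨ0 : ((Real.sqrt (zeroth x) : ℝ) : ℂ) • productVec α +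
      ∑ k, ((Real.sqrt (x k) : ℝ) : ℂ) • productVec (update α k (β k)) =
      wVec α β 0 fun k => (Real.sqrt (x k) : ℂ) := by
    simp [wVec, hx0]
  have hΘ : HasParam (wVec α β 0 fun k => (Real.sqrt (y k) : ℂ)) y :=
    ⟨hys, α, β, hfr, by simp [wVec, hy0]⟩
  have hz : (fun k => if k ∈ l then (Real.sqrt (P * y k / x k) : ℂ) * (Real.sqrt (x k) : ℂ)
      else (Real.sqrt (x k) : ℂ)) = (Real.sqrt P : ℂ) • fun k => (Real.sqrt (y k) : ℂ) := by
    ext k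
    have hk : (Real.sqrt P : ℂ) * (Real.sqrt (y k) : ℂ) = (Real.sqrt (P * y k) : ℂ) := by
      rw [Real.sqrt_mul hP0, Complex.ofReal_mul]
    rw [Pi.smul_apply, smul_eq_mul, hk]
    split_ifs with hkl
    · have hxk : 0 < x k := (hPy k).trans_lt ((hmem k).1 hkl)
      rw [← Complex.ofReal_mul, ← Real.sqrt_mul (div_nonneg (hPy k) hxk.le),
        div_mul_cancel₀ _ hxk.ne']
    · rw [le_antisymm (hle k) (not_lt.1 fun h => hkl ((hmem k).2 h))]
  have hvec : wVec α β 0 ((Real.sqrt P : ℂ) • fun k => (Real.sqrt (y k) : ℂ)) =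
      (Real.sqrt P : ℂ) • wVec α β 0 fun k => (Real.sqrt (y k) : ℂ) := by
    rw [smul_wVec, mul_zero]
  rw [hΨ0, hTP, hz, hvec, successProb_halt_smul hΘ (Real.sqrt_nonneg P), Real.sq_sqrt hP0]

end WType

end

theorem mainTheorem4 {p : ℕ} (d : Fin p → ℕ) (x y : Fin p → ℝ) (Ψ Θ : WType.State d)
    (hΨ : WType.HasParam Ψ x) (hΘ : WType.HasParam Θ y) (hy : WType.TrulyMultipartite Θ) :
    (∀ T : WType.Protocol d, WType.successProb y T Ψ ≤ WType.pBnd x y) ∧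
    (WType.zeroth x = 0 → WType.zeroth y = 0 →
      ∀ l : List (Fin p), l.Nodup → (∀ k, k ∈ l ↔ WType.pBnd x y * y k < x k) →
        ∃ T : WType.Protocol d, WType.IsSequentialTwoOutcome l T ∧
          WType.successProb y T Ψ = WType.pBnd x y) ∧
    (∀ t : ℝ, 0 < t → t < 1 → x = t • y →
      WType.pBnd x y = t ∧
        ∃ c : ℝ, c < WType.pBnd x y ∧
          ∀ T : WType.Protocol d, WType.successProb y T Ψ ≤ c) := by
  obtain ⟨R, hR, hyR⟩ := WType.exists_three_le_card_ne_zero hΘ hy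
  refine ⟨WType.successProb_le_pBnd hΨ hΘ.1.1 hR hyR, fun hx0 hy0 l hl hmem =>
    WType.exists_sequential_successProb_eq hΨ hΘ.1 hR hyR hx0 hy0 l hl hmem, ?_⟩
  rintro t ht0 ht1 rfl
  obtain ⟨k, hk⟩ := Finset.card_pos.1 (by omega : 0 < R.card)
  have hP := WType.pBnd_smul ht1.le (hyR k hk)
  refine ⟨hP, t ^ 2, ?_, WType.successProb_smul_le hΨ hΘ.1.1 hR hyR⟩
  rw [hP]
  nlinarith
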